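/- Let $\mathbb K$ be $\mathbb R$ or $\mathbb C$, let $E_1,\dots,E_m$ be infinite-dimensional Banach spaces over $\mathbb K$ and let $F$ be a Banach space over $\mathbb K$. For $1\le p\le\infty$, $\ell_p^w(E)$ denotes the set of sequences $(x_j)_{j\ge1}$ in $E$ such that $(\varphi(x_j))_j\in\ell_p$ for every continuous linear functional $\varphi$ on $E$, with the norm $\|(x_j)_j\|_{w,p}=\sup_{\|\varphi\|\le1}\|(\varphi(x_j))_j\|_{\ell_p}$. For $1\le p\le q\le\infty$, a multilinear operator $T:E_1\times\cdots\times E_m\to F$ is multiple $(q,p)$-summing if there is a constant $C>0$ such that $$\Big(\sum_{j_1,\dots,j_m=1}^\infty\|T(x^{(1)}_{j_1},\dots,x^{(m)}_{j_m})\|^q\Big)^{1/q}\le C\prod_{k=1}^m\|(x^{(k)}_j)_{j}\|_{w,p}$$ for all $(x^{(k)}_j)_j\in\ell_p^w(E_k)$, $k=1,\dots,m$ (with the supremum on the left-hand side if $q=\infty$); $\Pi_{(q,p)}(E_1,\dots,E_m;F)$ denotes the class of these operators. For $2\le q<\infty$, a Banach space $E$ has cotype $q$ if there is $C>0$ such that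 $(\sum_{k=1}^n\|x_k\|^q)^{1/q}\le C\big(\int_0^1\|\sum_{k=1}^n r_k(t)x_k\|^2\,dt\big)^{1/2}$ for all finite families $x_1,\dots,x_n\in E$, where $r_k(t)=\operatorname{sign}(\sin(2^k\pi t))$ is the $k$-th Rademacher function. Let $1\le r\le a\le\infty$ and $1\le s\le\infty$ satisfy $\frac1r-\frac1a\le1-\frac1s$ (where $\frac1\infty=0$). (a) If each of $E_1,\dots,E_m$ has cotype $2$ and $r\le2$, then $\Pi_{(a,r)}(E_1,\dots,E_m;F)\subset\Pi_{(s,1)}(E_1,\dots,E_m;F)$. (b) If each $E_i$ has cotype $q_i$ with $2<q_i<\infty$, $q=\max\{q_1,\dots,q_m\}$ and $1<r<q^*$, where $q^*=q/(q-1)$, then $\Pi_{(a,r)}(E_1,\dots,E_m;F)\subset\Pi_{(s,1)}(E_1,\dots,E_m;F)$. -/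

import Mathlib

open scoped ENNReal NNReal

/-- The `k`-th Rademacher function `r_k(t) = sign (sin (2^k π t))`, `k = 1, 2, …`. -/
noncomputable def rademacher (k : ℕ) (t : ℝ) : ℝ :=
  Real.sign (Real.sin (2 ^ k * Real.pi * t))

/-- `E` has cotype `q` (used for `2 ≤ q < ∞`): there is `C > 0` such that for all finite families
`x_1, …, x_n` in `E`,
`(∑ ‖x_k‖^q)^(1/q) ≤ C (∫_[0,1] ‖∑ r_k(t) x_k‖^2 dt)^(1/2)`.
The index `k : Fin n` runs over `0, …, n - 1`, whence the shift in the Rademacher functions. -/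
def HasCotype (𝕜 : Type*) [RCLike 𝕜] (E : Type*) [NormedAddCommGroup E] [NormedSpace 𝕜 E]
    (q : ℝ) : Prop :=
  ∃ C : ℝ, 0 < C ∧ ∀ (n : ℕ) (x : Fin n → E),
    (∑ k, ‖x k‖ ^ q) ^ (1 / q) ≤
      C * (∫ t in (0 : ℝ)..1,
        ‖∑ k : Fin n, ((rademacher ((k : ℕ) + 1) t : ℝ) : 𝕜) • x k‖ ^ 2) ^ ((1 : ℝ) / 2)

/-- The (extended) `ℓ_p`-norm of a family indexed by an arbitrary type, for `1 ≤ p ≤ ∞`: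
`(∑ ‖u i‖^p)^(1/p)` for `p < ∞` and `sup ‖u i‖` for `p = ∞`. -/
noncomputable def seqNorm {ι : Type*} {G : Type*} [NormedAddCommGroup G]
    (p : ℝ≥0∞) (u : ι → G) : ℝ≥0∞ :=
  if p = ∞ then ⨆ i, ‖u i‖ₑ else (∑' i, ‖u i‖ₑ ^ p.toReal) ^ (1 / p.toReal)

/-- `x ∈ ℓ_p^w(E)`: for every continuous linear functional `φ`, the scalar sequence `φ (x j)`
belongs to `ℓ_p`. -/
def WeaklySummable (𝕜 : Type*) [RCLike 𝕜] {E : Type*} [NormedAddCommGroup E] [NormedSpace 𝕜 E]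
    (p : ℝ≥0∞) (x : ℕ → E) : Prop :=
  ∀ φ : E →L[𝕜] 𝕜, Memℓp (fun j => φ (x j)) p

/-- The weak `ℓ_p`-norm `‖x‖_{w,p} = sup_{‖φ‖ ≤ 1} ‖(φ (x j))_j‖_p`. -/
noncomputable def weakNorm (𝕜 : Type*) [RCLike 𝕜] {E : Type*} [NormedAddCommGroup E]
    [NormedSpace 𝕜 E] (p : ℝ≥0∞) (x : ℕ → E) : ℝ≥0∞ :=
  ⨆ (φ : E →L[𝕜] 𝕜) (_ : ‖φ‖ ≤ 1), seqNorm p (fun j => φ (x j))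

/-- The class `Π_{(q,p)}(E_1, …, E_m; F)` of multiple `(q,p)`-summing multilinear operators
(used for `1 ≤ p ≤ q ≤ ∞`). The defining inequality, applied to sequences with a single nonzero
term, gives `‖T(x_1, …, x_m)‖ ≤ C ‖x_1‖ ⋯ ‖x_m‖`, so members of the class are automatically
continuous. -/
def multipleSumming (𝕜 : Type*) [RCLike 𝕜] {m : ℕ} (q p : ℝ≥0∞)
    (E : Fin m → Type*) [∀ i, NormedAddCommGroup (E i)] [∀ i, NormedSpace 𝕜 (E i)]
    (F : Type*) [NormedAddCommGroup F] [NormedSpace 𝕜 F] : Set (MultilinearMap 𝕜 E F) :=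
  {T | ∃ C : ℝ≥0, 0 < C ∧ ∀ x : (k : Fin m) → ℕ → E k, (∀ k, WeaklySummable 𝕜 p (x k)) →
    seqNorm q (fun j : Fin m → ℕ => T (fun k => x k (j k))) ≤ C * ∏ k, weakNorm 𝕜 p (x k)}

/-! Put `p = r*`. Under the cotype assumptions every weakly 1-summable sequence factors, on each
initial segment, as `x_j = α_j y_j` with `α` bounded in `ℓ_p` and `y` weakly `r`-summable, with
constants independent of the length. Multilinearity turns `T(x)` into `(∏ α) T(y)`, and Hölder
between `ℓ_p` and `ℓ_a` gives `ℓ_s`, because `1/s ≤ 1/p + 1/a` is the assumed relation between the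
exponents. For `r = 1` no factorization is needed: the relation says `a ≤ s`.

The factorization is dual to a Pietsch domination `‖u b‖ ≤ K (∑ ν_j |b_j|^p)^(1/p)` for the operator
`u : ℓ_∞^n → E`, `e_j ↦ x_j`; take `α_j = ν_j^(1/p)`. Cotype `q` makes `u` `(q,1)`-summing, which
yields a domination of Lorentz type `L_{q,1}` (`exists_weights_rpow_norm_le`) and, by dyadic
slicing, one in `L_p` for each `p > q` (`norm_le_mul_rpow_of_rpow_norm_le`). For cotype 2 the
endpoint `p = 2` follows by bootstrapping from `p = 4` with a fourth-moment Khinchin inequality. -/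

theorem Real.mul_rpow_sub_one_mul_le {q a b : ℝ} (hq : 1 < q) (ha : 0 ≤ a) (hb : 0 ≤ b) :
    q * (b ^ (q - 1) * a) ≤ a ^ q + (q - 1) * b ^ q := by
  have hq0 : 0 < q := by linarith
  have hq1 : q - 1 ≠ 0 := by linarith
  have h := Real.young_inequality_of_nonneg ha (Real.rpow_nonneg hb (q - 1))
    (Real.HolderConjugate.conjExponent hq)
  rw [Real.conjExponent, ← Real.rpow_mul hb, mul_div_cancel₀ _ hq1] at h
  have h2 := mul_le_mul_of_nonneg_left h hq0.le
  calc q * (b ^ (q - 1) * a) = q * (a * b ^ (q - 1)) := by ring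
    _ ≤ _ := h2
    _ = _ := by field_simp

/-! ### Domination of operators on `ℓ_∞^n` by weighted `ℓ_p` norms -/

section Domination

variable {𝕜 : Type*} [RCLike 𝕜] {E : Type*} [NormedAddCommGroup E] [NormedSpace 𝕜 E]
  {ι : Type*} [Fintype ι]

/-- A variational argument in place of Hahn–Banach separation. Choose an admissible family `f`
almost maximizing `∑ ‖u (f i)‖^q`, and let the weights be the moduli of the functional obtained by
linearizing this sum at `f`. Adjoining `b` and shrinking `f` to make room gives a competitor;
near-maximality bounds `‖u b‖^q` by the loss caused by shrinking, up to `ε`. -/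
theorem exists_weights_rpow_norm_le_add {u : (ι → 𝕜) →ₗ[𝕜] E} {q θ D ε : ℝ} (hq : 1 < q)
    (hθ : 1 ≤ θ) (hε : 0 < ε)
    (H : ∀ (N : ℕ) (f : Fin N → ι → 𝕜), (∀ j, ∑ i, ‖f i j‖ ^ θ ≤ 1) →
      ∑ i, ‖u (f i)‖ ^ q ≤ D) :
    ∃ ν : ι → ℝ, (∀ j, 0 ≤ ν j) ∧ ∑ j, ν j ≤ D ∧
      ∀ b : ι → 𝕜, (∀ j, ‖b j‖ ≤ 1) → ‖u b‖ ^ q ≤ q * ∑ j, ν j * ‖b j‖ ^ θ + ε := by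
  classical
  have hq0 : 0 < q := by linarith
  have hθ0 : 0 < θ := by linarith
  let S : Set ℝ := {v | ∃ (N : ℕ) (f : Fin N → ι → 𝕜), (∀ j, ∑ i, ‖f i j‖ ^ θ ≤ 1) ∧
    ∑ i, ‖u (f i)‖ ^ q = v}
  have hSne : S.Nonempty := ⟨0, 0, Fin.elim0, by simp, by simp⟩
  have hSb : BddAbove S := ⟨D, by rintro _ ⟨N, f, hf, rfl⟩; exact H N f hf⟩
  obtain ⟨V, ⟨N, f, hf, hV⟩, hVS⟩ := exists_lt_of_lt_csSup hSne (sub_lt_self (sSup S) hε)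
  choose ξ hξ1 hξ using fun i => exists_dual_vector'' 𝕜 (u (f i))
  let w : Fin N → ℝ := fun i => ‖u (f i)‖ ^ (q - 1)
  have hw : ∀ i, 0 ≤ w i := fun i => by positivity
  -- Coefficients of `g ↦ ∑ w_i ξ_i(u (g f_i))`, which takes the value `V` at `g = 1`.
  let c : ι → 𝕜 := fun j => ∑ i, (w i : 𝕜) * (f i j * ξ i (u (Pi.single j 1)))
  have hc : ∀ g : ι → 𝕜, ∑ j, g j * c j = ∑ i, (w i : 𝕜) * ξ i (u (g * f i)) := by
    intro g
    simp only [c, Finset.mul_sum]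
    rw [Finset.sum_comm]
    refine Finset.sum_congr rfl fun i _ => ?_
    rw [LinearMap.pi_apply_eq_sum_univ u (g * f i), map_sum, Finset.mul_sum]
    refine Finset.sum_congr rfl fun j _ => ?_
    have : (Pi.single j 1 : ι → 𝕜) = fun k => if j = k then 1 else 0 := by
      ext k; simp [Pi.single_apply, eq_comm]
    rw [this, map_smul, smul_eq_mul, Pi.mul_apply]
    ring
  have hnorm : ∀ i (g : ι → 𝕜), ‖(w i : 𝕜) * ξ i (u (g * f i))‖ ≤ w i * ‖u (g * f i)‖ := by
    intro i g
    rw [norm_mul, RCLike.norm_ofReal, abs_of_nonneg (hw i)]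
    refine mul_le_mul_of_nonneg_left ?_ (hw i)
    simpa using (ξ i).le_of_opNorm_le (hξ1 i) (u (g * f i))
  have hV' : ∑ j, c j = (V : 𝕜) := by
    have := hc 1
    simp only [Pi.one_apply, one_mul] at this
    rw [this, ← hV]
    push_cast
    refine Finset.sum_congr rfl fun i _ => ?_
    rw [hξ, ← RCLike.ofReal_mul]
    congr 1
    simp only [w]
    rcases (norm_nonneg (u (f i))).eq_or_lt with h | h
    · rw [← h, Real.zero_rpow hq0.ne', mul_zero]
    · rw [Real.rpow_sub_one h.ne', div_mul_cancel₀ _ h.ne']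
  refine ⟨fun j => ‖c j‖, fun j => norm_nonneg _, ?_, ?_⟩
  -- Rotating `f` by the phases `ω` keeps it admissible and turns `∑ c_j` into `∑ ‖c_j‖`; Young's
  -- inequality then bounds the total mass by `D`.
  · choose ω hω1 hω using fun j => RCLike.exists_norm_eq_mul_self (c j)
    have h1 : ∑ j, ‖c j‖ ≤ ∑ i, w i * ‖u (ω * f i)‖ := by
      have : ((∑ j, ‖c j‖ : ℝ) : 𝕜) = ∑ i, (w i : 𝕜) * ξ i (u (ω * f i)) := by
        rw [← hc]; push_cast; exact Finset.sum_congr rfl fun j _ => hω j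
      calc ∑ j, ‖c j‖ = ‖((∑ j, ‖c j‖ : ℝ) : 𝕜)‖ := by
            rw [RCLike.norm_ofReal, abs_of_nonneg (Finset.sum_nonneg fun _ _ => norm_nonneg _)]
        _ ≤ _ := by
            rw [this]
            exact (norm_sum_le _ _).trans (Finset.sum_le_sum fun i _ => hnorm i ω)
    have h2 : q * ∑ i, w i * ‖u (ω * f i)‖ ≤
        ∑ i, ‖u (ω * f i)‖ ^ q + (q - 1) * ∑ i, ‖u (f i)‖ ^ q := by
      rw [Finset.mul_sum, Finset.mul_sum, ← Finset.sum_add_distrib]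
      exact Finset.sum_le_sum fun i _ =>
        Real.mul_rpow_sub_one_mul_le hq (norm_nonneg _) (norm_nonneg _)
    have h3 := H N (fun i => ω * f i) (fun j => by simpa [hω1] using hf j)
    have h4 := mul_le_mul_of_nonneg_left (H N f hf) (sub_nonneg.2 hq.le)
    have h5 : q * ∑ i, w i * ‖u (ω * f i)‖ ≤ q * D := by linarith
    exact h1.trans (le_of_mul_le_mul_left h5 hq0)
  · intro b hb
    have hb1 : ∀ j, 0 ≤ 1 - ‖b j‖ ^ θ := fun j =>
      sub_nonneg.2 (Real.rpow_le_one (norm_nonneg _) (hb j) hθ0.le)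
    -- The largest shrinking factor in general: `‖b‖^θ + g^θ ∑ ‖f_i‖^θ ≤ 1`. Since `θ ≥ 1`, the loss
    -- `1 - g` is at most `‖b‖^θ`.
    let g : ι → ℝ := fun j => (1 - ‖b j‖ ^ θ) ^ (1 / θ)
    have hg0 : ∀ j, 0 ≤ g j := fun j => Real.rpow_nonneg (hb1 j) _
    have hgθ : ∀ j, g j ^ θ = 1 - ‖b j‖ ^ θ := fun j => by
      simp only [g]
      rw [← Real.rpow_mul (hb1 j), one_div_mul_cancel hθ0.ne', Real.rpow_one]
    have hg1 : ∀ j, 1 - ‖b j‖ ^ θ ≤ g j := fun j =>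
      Real.self_le_rpow_of_le_one (hb1 j) (by linarith [Real.rpow_nonneg (norm_nonneg (b j)) θ])
        (by rw [div_le_one hθ0]; exact hθ)
    have hgle : ∀ j, g j ≤ 1 := fun j =>
      Real.rpow_le_one (hb1 j) (by linarith [Real.rpow_nonneg (norm_nonneg (b j)) θ]) (by positivity)
    let G : ι → 𝕜 := fun j => (g j : 𝕜)
    have hmem : ‖u b‖ ^ q + ∑ i, ‖u (G * f i)‖ ^ q ∈ S := by
      refine ⟨N + 1, Fin.cons b fun i => G * f i, fun j => ?_, ?_⟩
      · simp only [Fin.sum_univ_succ, Fin.cons_zero, Fin.cons_succ, Pi.mul_apply, norm_mul, G,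
          RCLike.norm_ofReal, abs_of_nonneg (hg0 _)]
        simp only [Real.mul_rpow (hg0 j) (norm_nonneg _), hgθ]
        rw [← Finset.mul_sum]
        nlinarith [mul_le_mul_of_nonneg_left (hf j) (hb1 j)]
      · simp only [Fin.sum_univ_succ, Fin.cons_zero, Fin.cons_succ]
    have h1 := le_csSup hSb hmem
    have h2 : q * ∑ i, w i * ‖u (G * f i)‖ ≤
        ∑ i, ‖u (G * f i)‖ ^ q + (q - 1) * V := by
      rw [← hV, Finset.mul_sum, Finset.mul_sum, ← Finset.sum_add_distrib]
      exact Finset.sum_le_sum fun i _ =>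
        Real.mul_rpow_sub_one_mul_le hq (norm_nonneg _) (norm_nonneg _)
    have h3 : RCLike.re (∑ j, G j * c j) ≤ ∑ i, w i * ‖u (G * f i)‖ := by
      rw [hc]
      exact (RCLike.re_le_norm _).trans
        ((norm_sum_le _ _).trans (Finset.sum_le_sum fun i _ => hnorm i G))
    have h4 : V - ∑ j, ‖c j‖ * ‖b j‖ ^ θ ≤ RCLike.re (∑ j, G j * c j) := by
      have hVre : V = ∑ j, RCLike.re (c j) := by
        rw [← map_sum, hV', RCLike.ofReal_re]
      rw [hVre, map_sum, ← Finset.sum_sub_distrib]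
      refine Finset.sum_le_sum fun j _ => ?_
      simp only [G, RCLike.re_ofReal_mul]
      have e1 := RCLike.re_le_norm (c j)
      have e2 := mul_le_mul_of_nonneg_right e1 (sub_nonneg.2 (hgle j))
      have e3 := mul_le_mul_of_nonneg_left (hg1 j) (norm_nonneg (c j))
      nlinarith
    have h5 := mul_le_mul_of_nonneg_left (h4.trans h3) hq0.le
    nlinarith

/-- Weights for `ε = 1/(k+1)` stay in the compact box `[0, D]^ι`; a limit point works for `ε = 0`.
-/
theorem exists_weights_rpow_norm_le {u : (ι → 𝕜) →ₗ[𝕜] E} {q θ D : ℝ} (hq : 1 < q)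
    (hθ : 1 ≤ θ)
    (H : ∀ (N : ℕ) (f : Fin N → ι → 𝕜), (∀ j, ∑ i, ‖f i j‖ ^ θ ≤ 1) →
      ∑ i, ‖u (f i)‖ ^ q ≤ D) :
    ∃ ν : ι → ℝ, (∀ j, 0 ≤ ν j) ∧ ∑ j, ν j ≤ D ∧
      ∀ b : ι → 𝕜, (∀ j, ‖b j‖ ≤ 1) → ‖u b‖ ^ q ≤ q * ∑ j, ν j * ‖b j‖ ^ θ := by
  choose ν hν0 hνD hν using fun k : ℕ =>
    exists_weights_rpow_norm_le_add (ε := 1 / ((k : ℝ) + 1)) hq hθ (by positivity) H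
  have hmem : ∀ k, ν k ∈ Set.Icc (0 : ι → ℝ) (fun _ => D) := fun k =>
    ⟨hν0 k, fun j => (Finset.single_le_sum (fun i _ => hν0 k i) (Finset.mem_univ j)).trans (hνD k)⟩
  obtain ⟨μ, hμ, φ, hφ, hlim⟩ := isCompact_Icc.tendsto_subseq hmem
  have hlimj : ∀ j, Filter.Tendsto (fun k => ν (φ k) j) Filter.atTop (nhds (μ j)) :=
    fun j => (tendsto_pi_nhds.1 hlim) j
  refine ⟨μ, hμ.1, le_of_tendsto' (tendsto_finsetSum _ fun j _ => hlimj j) fun k => hνD _,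
    fun b hb => ?_⟩
  have h1 : Filter.Tendsto (fun k => q * ∑ j, ν (φ k) j * ‖b j‖ ^ θ + 1 / ((φ k : ℝ) + 1))
      Filter.atTop (nhds (q * ∑ j, μ j * ‖b j‖ ^ θ + 0)) :=
    ((tendsto_finsetSum _ fun j _ => (hlimj j).mul_const _).const_mul q).add
      (tendsto_one_div_add_atTop_nhds_zero_nat.comp hφ.tendsto_atTop)
  rw [add_zero] at h1
  exact ge_of_tendsto' h1 fun k => hν _ b hb

theorem le_mul_rpow_of_homogeneous {u : (ι → 𝕜) →ₗ[𝕜] E} {p K : ℝ} {ν : ι → ℝ} (hp : 0 < p)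
    (hν : ∀ j, 0 ≤ ν j)
    (h : ∀ b : ι → 𝕜, ∑ j, ν j * ‖b j‖ ^ p ≤ 1 → ‖u b‖ ≤ K) (b : ι → 𝕜) :
    ‖u b‖ ≤ K * (∑ j, ν j * ‖b j‖ ^ p) ^ (1 / p) := by
  set A := ∑ j, ν j * ‖b j‖ ^ p with hA
  have hA0 : 0 ≤ A := Finset.sum_nonneg fun j _ => mul_nonneg (hν j) (by positivity)
  have hK : 0 ≤ K := by
    have := h 0 (by simp [Real.zero_rpow hp.ne'])
    simpa using this
  -- Scaling by `t > A^(1/p)` rather than by `A^(1/p)` itself covers `A = 0`.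
  have key : ∀ t : ℝ, A ^ (1 / p) < t → ‖u b‖ ≤ K * t := by
    intro t ht
    have ht0 : 0 < t := (Real.rpow_nonneg hA0 _).trans_lt ht
    have h1 : ∑ j, ν j * ‖((t⁻¹ : ℝ) : 𝕜) * b j‖ ^ p ≤ 1 := by
      have : ∑ j, ν j * ‖((t⁻¹ : ℝ) : 𝕜) * b j‖ ^ p = (t ^ p)⁻¹ * A := by
        rw [hA, Finset.mul_sum]
        refine Finset.sum_congr rfl fun j _ => ?_
        rw [norm_mul, RCLike.norm_ofReal, abs_of_pos (inv_pos.2 ht0),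
          Real.mul_rpow (inv_pos.2 ht0).le (norm_nonneg _), Real.inv_rpow ht0.le]
        ring
      rw [this, inv_mul_le_one₀ (by positivity)]
      have h2 := Real.rpow_le_rpow (Real.rpow_nonneg hA0 _) ht.le hp.le
      rwa [← Real.rpow_mul hA0, one_div_mul_cancel hp.ne', Real.rpow_one] at h2
    have h2 := h (((t⁻¹ : ℝ) : 𝕜) • b) (by simpa using h1)
    rw [map_smul, norm_smul, RCLike.norm_ofReal, abs_of_pos (inv_pos.2 ht0)] at h2
    rwa [inv_mul_le_iff₀ ht0, mul_comm] at h2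
  refine le_of_forall_gt_imp_ge_of_dense ?_
  intro s hs
  by_contra hlt
  push Not at hlt
  rcases hK.eq_or_lt with h0 | h0
  · have := key (A ^ (1 / p) + 1) (by linarith)
    rw [← h0] at this hs
    simp at this hs
    rw [this, norm_zero] at hlt
    linarith
  · have := key (s / K) (by rwa [lt_div_iff₀ h0, mul_comm])
    rw [mul_div_cancel₀ _ h0.ne'] at this
    linarith

/-- Finite-dimensional form of `L_p ⊂ L_{q,1}` for `p > q`. Normalize `∑ ν |b|^p ≤ 1` and slice `b`
dyadically: the slice `2^k < |b_j| ≤ 2^(k+1)` has mass at most `2^(-kp)`, so it contributes a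
constant times `2^(k(1 - p/q))`, a geometric series. The part with `|b_j| ≤ 1` accounts for the
summand 1. -/
theorem norm_le_mul_rpow_of_rpow_norm_le {u : (ι → 𝕜) →ₗ[𝕜] E} {p q : ℝ} {ν : ι → ℝ}
    (hq : 1 < q) (hpq : q < p) (hν : ∀ j, 0 ≤ ν j)
    (hu : ∀ b : ι → 𝕜, (∀ j, ‖b j‖ ≤ 1) → ‖u b‖ ≤ 1)
    (hb : ∀ b : ι → 𝕜, (∀ j, ‖b j‖ ≤ 1) → ‖u b‖ ^ q ≤ q * ∑ j, ν j * ‖b j‖) (b : ι → 𝕜) :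
    ‖u b‖ ≤ (1 + 2 * q ^ (1 / q) * (1 - 2 ^ (1 - p / q))⁻¹) *
      (∑ j, ν j * ‖b j‖ ^ p) ^ (1 / p) := by
  classical
  have hq0 : 0 < q := by linarith
  have hp0 : 0 < p := by linarith
  refine le_mul_rpow_of_homogeneous hp0 hν (fun b hA => ?_) b
  set ρ : ℝ := 2 ^ (1 - p / q) with hρ
  have hρ0 : 0 < ρ := by positivity
  have hρ1 : ρ < 1 := Real.rpow_lt_one_of_one_lt_of_neg (by norm_num)
    (by rw [sub_neg, lt_div_iff₀ hq0]; linarith)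
  let B : ℕ → ι → 𝕜 := fun k j => if ‖b j‖ ≤ 2 ^ k then b j else 0
  have hstep : ∀ k, ‖u (B (k + 1) - B k)‖ ≤ 2 * q ^ (1 / q) * ρ ^ k := by
    intro k
    have hd : ∀ j, (B (k + 1) - B k) j = if 2 ^ k < ‖b j‖ ∧ ‖b j‖ ≤ 2 ^ (k + 1) then b j else 0 := by
      intro j
      have : (2 : ℝ) ^ k ≤ 2 ^ (k + 1) := pow_le_pow_right₀ (by norm_num) (by omega)
      simp only [B, Pi.sub_apply]
      by_cases h1 : ‖b j‖ ≤ 2 ^ k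
      · simp [h1, h1.trans this, not_lt.2 h1]
      · simp [h1, not_le.1 h1]
    set d := B (k + 1) - B k with hd'
    have h2k : (0 : ℝ) < 2 ^ (k + 1) := by positivity
    let e : ι → 𝕜 := (((2 ^ (k + 1))⁻¹ : ℝ) : 𝕜) • d
    have hen : ∀ j, ‖e j‖ = (2 ^ (k + 1))⁻¹ * ‖d j‖ := fun j => by
      simp only [e, Pi.smul_apply, smul_eq_mul, norm_mul, RCLike.norm_ofReal,
        abs_of_pos (inv_pos.2 h2k)]
    have he1 : ∀ j, ‖e j‖ ≤ 1 := fun j => by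
      rw [hen, inv_mul_le_one₀ h2k, hd]
      split_ifs with h
      · exact h.2
      · simp
    have he2 : ∀ j, ‖e j‖ ≤ (2 : ℝ) ^ (-(k * p) : ℝ) * ‖b j‖ ^ p := fun j => by
      by_cases h : 2 ^ k < ‖b j‖ ∧ ‖b j‖ ≤ 2 ^ (k + 1)
      · refine (he1 j).trans ?_
        rw [Real.rpow_neg (by norm_num), Real.rpow_mul (by norm_num), Real.rpow_natCast,
          ← div_eq_inv_mul, one_le_div (by positivity)]
        exact Real.rpow_le_rpow (by positivity) h.1.le hp0.le
      · rw [hen, hd, if_neg h, norm_zero, mul_zero]; positivity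
    have h1 : ‖u e‖ ^ q ≤ q * (2 : ℝ) ^ (-(k * p) : ℝ) := by
      refine (hb e he1).trans (mul_le_mul_of_nonneg_left ?_ hq0.le)
      calc ∑ j, ν j * ‖e j‖ ≤ ∑ j, (2 : ℝ) ^ (-(k * p) : ℝ) * (ν j * ‖b j‖ ^ p) :=
            Finset.sum_le_sum fun j _ => by
              rw [mul_left_comm]; exact mul_le_mul_of_nonneg_left (he2 j) (hν j)
        _ ≤ _ := by
            rw [← Finset.mul_sum]
            exact mul_le_of_le_one_right (by positivity) hA
    have h2 : ‖u e‖ ≤ q ^ (1 / q) * (2 : ℝ) ^ (-(k * p / q) : ℝ) := by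
      have := Real.rpow_le_rpow (by positivity) h1 (z := 1 / q) (by positivity)
      rw [← Real.rpow_mul (norm_nonneg _), mul_one_div_cancel hq0.ne', Real.rpow_one,
        Real.mul_rpow hq0.le (by positivity), ← Real.rpow_mul (by norm_num)] at this
      convert this using 3
      ring
    have h3 : ‖u e‖ = (2 ^ (k + 1))⁻¹ * ‖u d‖ := by
      simp only [e, map_smul, norm_smul, RCLike.norm_ofReal, abs_of_pos (inv_pos.2 h2k)]
    rw [h3, inv_mul_le_iff₀ h2k] at h2
    refine h2.trans (le_of_eq ?_)
    have h4 : ρ ^ k = 2 ^ k * (2 : ℝ) ^ (-(k * p / q) : ℝ) := by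
      rw [hρ, ← Real.rpow_natCast, ← Real.rpow_mul (by norm_num), ← Real.rpow_natCast 2 k,
        ← Real.rpow_add (by norm_num)]
      congr 1
      ring
    rw [h4, pow_succ]
    ring
  have hBk : ∀ k, ‖u (B k)‖ ≤ 1 + 2 * q ^ (1 / q) * ∑ i ∈ Finset.range k, ρ ^ i := by
    intro k
    induction k with
    | zero =>
      simp only [Finset.range_zero, Finset.sum_empty, mul_zero, add_zero]
      refine hu _ fun j => ?_
      simp only [B, pow_zero]
      split_ifs with h
      · exact h
      · simp
    | succ k ih =>
      rw [Finset.sum_range_succ, mul_add, ← add_assoc]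
      calc ‖u (B (k + 1))‖ = ‖u (B k) + u (B (k + 1) - B k)‖ := by rw [← map_add]; congr 2; abel
        _ ≤ _ := (norm_add_le _ _).trans (add_le_add ih (hstep k))
  obtain ⟨k, hk⟩ : ∃ k : ℕ, ∀ j, ‖b j‖ ≤ 2 ^ k := by
    obtain ⟨k, hk⟩ := pow_unbounded_of_one_lt (∑ j, ‖b j‖) (one_lt_two (α := ℝ))
    exact ⟨k, fun j => (Finset.single_le_sum (fun i _ => norm_nonneg (b i))
      (Finset.mem_univ j)).trans hk.le⟩
  have hBb : B k = b := by ext j; simp [B, hk j]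
  rw [← hBb]
  refine (hBk k).trans ?_
  gcongr
  rw [← tsum_geometric_of_lt_one hρ0.le hρ1]
  exact (summable_geometric_of_lt_one hρ0.le hρ1).sum_le_tsum _ fun i _ => by positivity

end Domination

/-! ### Second and fourth moments of Rademacher sums -/

section Rademacher

theorem measurable_rademacher (k : ℕ) : Measurable (rademacher k) := by
  have h : Measurable Real.sign :=
    Measurable.ite measurableSet_Iio measurable_const
      (Measurable.ite measurableSet_Ioi measurable_const measurable_const)
  unfold rademacher
  fun_prop

theorem abs_rademacher_le_one (k : ℕ) (t : ℝ) : |rademacher k t| ≤ 1 := by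
  unfold rademacher
  rcases Real.sign_apply_eq (Real.sin (2 ^ k * Real.pi * t)) with h | h | h <;> simp [h]

theorem rademacher_succ (k : ℕ) (t : ℝ) : rademacher (k + 1) t = rademacher k (2 * t) := by
  unfold rademacher
  congr 2
  ring

theorem rademacher_periodic (k : ℕ) : Function.Periodic (rademacher (k + 1)) 1 := by
  intro t
  unfold rademacher
  have : (2 : ℝ) ^ (k + 1) * Real.pi * (t + 1) =
      2 ^ (k + 1) * Real.pi * t + ((2 ^ k : ℕ) : ℝ) * (2 * Real.pi) := by
    push_cast; ring
  rw [this, Real.sin_add_nat_mul_two_pi]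

theorem rademacher_one_of_lt {t : ℝ} (h0 : 0 < t) (h1 : t < 1 / 2) : rademacher 1 t = 1 := by
  unfold rademacher
  refine Real.sign_of_pos (Real.sin_pos_of_pos_of_lt_pi ?_ ?_) <;>
    nlinarith [Real.pi_pos]

theorem rademacher_one_of_gt {t : ℝ} (h0 : 1 / 2 < t) (h1 : t < 1) : rademacher 1 t = -1 := by
  unfold rademacher
  have : (2 : ℝ) ^ 1 * Real.pi * t = 2 * Real.pi * (t - 1) + 2 * Real.pi := by ring
  rw [this, Real.sin_add_two_pi]
  refine Real.sign_of_neg (Real.sin_neg_of_neg_of_neg_pi_lt ?_ ?_) <;>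
    nlinarith [Real.pi_pos]

/-- The Rademacher sum `∑ r_k(t) x_k` with real coefficients. -/
noncomputable def rademacherSum {n : ℕ} (x : Fin n → ℝ) (t : ℝ) : ℝ :=
  ∑ k : Fin n, rademacher ((k : ℕ) + 1) t * x k

theorem rademacherSum_succ {n : ℕ} (x : Fin (n + 1) → ℝ) (t : ℝ) :
    rademacherSum x t = rademacher 1 t * x 0 + rademacherSum (Fin.tail x) (2 * t) := by
  simp [rademacherSum, Fin.sum_univ_succ, rademacher_succ, Fin.tail]

theorem measurable_rademacherSum {n : ℕ} (x : Fin n → ℝ) : Measurable (rademacherSum x) :=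
  Finset.measurable_fun_sum _ fun _ _ => (measurable_rademacher _).mul_const _

theorem rademacherSum_periodic {n : ℕ} (x : Fin n → ℝ) :
    Function.Periodic (rademacherSum x) 1 := fun t => by
  simp only [rademacherSum, rademacher_periodic _ t]

theorem abs_rademacherSum_le {n : ℕ} (x : Fin n → ℝ) (t : ℝ) :
    |rademacherSum x t| ≤ ∑ k, |x k| := by
  refine (Finset.abs_sum_le_sum_abs _ _).trans (Finset.sum_le_sum fun k _ => ?_)
  rw [abs_mul]
  exact mul_le_of_le_one_left (abs_nonneg _) (abs_rademacher_le_one _ _)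

theorem intervalIntegrable_comp_rademacherSum {n : ℕ} (x : Fin n → ℝ) {G : ℝ → ℝ}
    (hG : Continuous G) (a b : ℝ) :
    IntervalIntegrable (fun t => G (rademacherSum x t)) MeasureTheory.volume a b := by
  obtain ⟨M, hM⟩ := (isCompact_Icc (a := -∑ k, |x k|) (b := ∑ k, |x k|)).exists_bound_of_continuousOn
    hG.continuousOn
  refine (intervalIntegrable_const (c := M)).mono_fun
    (hG.measurable.comp (measurable_rademacherSum x)).aestronglyMeasurable
    (Filter.Eventually.of_forall fun t => ?_)
  exact (hM _ (abs_le.1 (abs_rademacherSum_le x t))).trans (le_abs_self M)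

/-- The first sign is constant on each half of `[0,1]`, and `t ↦ 2t` maps each half onto a full
period of the remaining sum. This is the only form of independence used; the moments follow by
induction. -/
theorem integral_comp_rademacherSum_succ {n : ℕ} (x : Fin (n + 1) → ℝ) {G : ℝ → ℝ}
    (hG : Continuous G) :
    ∫ t in (0 : ℝ)..1, G (rademacherSum x t) =
      2⁻¹ * ∫ t in (0 : ℝ)..1, (G (x 0 + rademacherSum (Fin.tail x) t) +
        G (-x 0 + rademacherSum (Fin.tail x) t)) := by
  rw [← intervalIntegral.integral_add_adjacent_intervals
    (intervalIntegrable_comp_rademacherSum x hG 0 (1 / 2))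
    (intervalIntegrable_comp_rademacherSum x hG (1 / 2) 1),
    intervalIntegral.integral_add
      (intervalIntegrable_comp_rademacherSum _ (G := fun s => G (x 0 + s)) (by fun_prop) 0 1)
      (intervalIntegrable_comp_rademacherSum _ (G := fun s => G (-x 0 + s)) (by fun_prop) 0 1),
    mul_add]
  congr 1
  · rw [intervalIntegral.integral_congr_Ioo_of_le (by norm_num)
      (g := fun t => G (x 0 + rademacherSum (Fin.tail x) (2 * t)))]
    · rw [intervalIntegral.integral_comp_mul_left
        (fun s => G (x 0 + rademacherSum (Fin.tail x) s)) two_ne_zero]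
      simp
    · intro t ht
      simp only [rademacherSum_succ, rademacher_one_of_lt ht.1 ht.2, one_mul]
  · rw [intervalIntegral.integral_congr_Ioo_of_le (by norm_num)
      (g := fun t => G (-x 0 + rademacherSum (Fin.tail x) (2 * t)))]
    · rw [intervalIntegral.integral_comp_mul_left
        (fun s => G (-x 0 + rademacherSum (Fin.tail x) s)) two_ne_zero]
      have hper : Function.Periodic (fun s => G (-x 0 + rademacherSum (Fin.tail x) s)) 1 :=
        fun s => by simp only [rademacherSum_periodic _ s]
      have := hper.intervalIntegral_add_eq 1 0
      norm_num at this ⊢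
      exact this
    · intro t ht
      simp only [rademacherSum_succ, rademacher_one_of_gt ht.1 ht.2, neg_one_mul]

theorem integral_rademacherSum_sq {n : ℕ} (x : Fin n → ℝ) :
    ∫ t in (0 : ℝ)..1, rademacherSum x t ^ 2 = ∑ k, x k ^ 2 := by
  induction n with
  | zero => simp [rademacherSum]
  | succ n ih =>
    rw [integral_comp_rademacherSum_succ x (continuous_pow 2), Fin.sum_univ_succ]
    have h : ∀ t, (x 0 + rademacherSum (Fin.tail x) t) ^ 2 +
        (-x 0 + rademacherSum (Fin.tail x) t) ^ 2 =
        2 * x 0 ^ 2 + 2 * rademacherSum (Fin.tail x) t ^ 2 := fun t => by ring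
    simp only [h]
    rw [intervalIntegral.integral_add intervalIntegrable_const
      ((intervalIntegrable_comp_rademacherSum _ (continuous_pow 2) 0 1).const_mul 2),
      intervalIntegral.integral_const, intervalIntegral.integral_const_mul, ih]
    simp [Fin.tail]
    ring

theorem integral_rademacherSum_pow_four_le {n : ℕ} (x : Fin n → ℝ) :
    ∫ t in (0 : ℝ)..1, rademacherSum x t ^ 4 ≤ 3 * (∑ k, x k ^ 2) ^ 2 := by
  induction n with
  | zero => simp [rademacherSum]
  | succ n ih =>
    rw [integral_comp_rademacherSum_succ x (continuous_pow 4), Fin.sum_univ_succ]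
    have h : ∀ t, (x 0 + rademacherSum (Fin.tail x) t) ^ 4 +
        (-x 0 + rademacherSum (Fin.tail x) t) ^ 4 =
        2 * x 0 ^ 4 + 12 * x 0 ^ 2 * rademacherSum (Fin.tail x) t ^ 2 +
        2 * rademacherSum (Fin.tail x) t ^ 4 := fun t => by ring
    simp only [h]
    have i2 := (intervalIntegrable_comp_rademacherSum (Fin.tail x) (continuous_pow 2) 0 1).const_mul
      (12 * x 0 ^ 2)
    have i4 := (intervalIntegrable_comp_rademacherSum (Fin.tail x) (continuous_pow 4) 0 1).const_mul 2
    rw [intervalIntegral.integral_add (intervalIntegrable_const.add i2) i4,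
      intervalIntegral.integral_add intervalIntegrable_const i2,
      intervalIntegral.integral_const, intervalIntegral.integral_const_mul,
      intervalIntegral.integral_const_mul, integral_rademacherSum_sq]
    have := ih (Fin.tail x)
    simp only [Fin.tail] at this ⊢
    simp only [sub_zero, one_smul]
    nlinarith [sq_nonneg (x 0 ^ 2)]

variable {𝕜 : Type*} [RCLike 𝕜]

theorem norm_sum_rademacher_mul_pow_four_le {n : ℕ} (f : Fin n → 𝕜) (t : ℝ) :
    ‖∑ k : Fin n, ((rademacher ((k : ℕ) + 1) t : ℝ) : 𝕜) * f k‖ ^ 4 ≤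
      2 * rademacherSum (fun k => RCLike.re (f k)) t ^ 4 +
      2 * rademacherSum (fun k => RCLike.im (f k)) t ^ 4 := by
  have h : ∀ z : 𝕜, ‖z‖ ^ 4 ≤ 2 * RCLike.re z ^ 4 + 2 * RCLike.im z ^ 4 := fun z => by
    have : ‖z‖ ^ 4 = (RCLike.re z * RCLike.re z + RCLike.im z * RCLike.im z) ^ 2 := by
      rw [← RCLike.normSq_apply, RCLike.normSq_eq_def']; ring
    rw [this]
    nlinarith [sq_nonneg (RCLike.re z ^ 2 - RCLike.im z ^ 2)]
  refine (h _).trans (le_of_eq ?_)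
  simp only [map_sum, RCLike.re_ofReal_mul, RCLike.im_ofReal_mul, rademacherSum]

/-- The bound is `2·3·(A² + B²)` with `A + B ≤ 1`, where `A` and `B` are the square sums of the real
and imaginary parts. -/
theorem integral_re_im_rademacherSum_le {n : ℕ} (f : Fin n → 𝕜) (hf : ∑ k, ‖f k‖ ^ 2 ≤ 1) :
    ∫ t in (0 : ℝ)..1, (2 * rademacherSum (fun k => RCLike.re (f k)) t ^ 4 +
      2 * rademacherSum (fun k => RCLike.im (f k)) t ^ 4) ≤ 6 := by
  rw [intervalIntegral.integral_add
    ((intervalIntegrable_comp_rademacherSum _ (continuous_pow 4) 0 1).const_mul 2)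
    ((intervalIntegrable_comp_rademacherSum _ (continuous_pow 4) 0 1).const_mul 2),
    intervalIntegral.integral_const_mul, intervalIntegral.integral_const_mul]
  have h1 := integral_rademacherSum_pow_four_le (fun k => RCLike.re (f k))
  have h2 := integral_rademacherSum_pow_four_le (fun k => RCLike.im (f k))
  have h3 : ∑ k, RCLike.re (f k) ^ 2 + ∑ k, RCLike.im (f k) ^ 2 ≤ 1 := by
    rw [← Finset.sum_add_distrib]
    refine le_trans (Finset.sum_le_sum fun k _ => le_of_eq ?_) hf
    have := RCLike.normSq_apply (f k)
    rw [RCLike.normSq_eq_def'] at this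
    rw [this]; ring
  have h4 : 0 ≤ ∑ k, RCLike.re (f k) ^ 2 := Finset.sum_nonneg fun _ _ => sq_nonneg _
  have h5 : 0 ≤ ∑ k, RCLike.im (f k) ^ 2 := Finset.sum_nonneg fun _ _ => sq_nonneg _
  nlinarith [mul_nonneg h4 h5]

end Rademacher

/-! ### Cotype implies Pietsch domination -/

section Cotype

variable {𝕜 : Type*} [RCLike 𝕜] {E : Type*} [NormedAddCommGroup E] [NormedSpace 𝕜 E]

/-- Operators from `ℓ_∞^n` to `E` of norm at most one are dominated, in the sense of Pietsch, by
`L_p`-norms of measures on `n` points, with constants that do not depend on `n`. -/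
def HasPietschDomination (𝕜 : Type*) [RCLike 𝕜] (E : Type*) [NormedAddCommGroup E]
    [NormedSpace 𝕜 E] (p : ℝ) : Prop :=
  ∃ K : ℝ, 0 < K ∧ ∀ (n : ℕ) (u : (Fin n → 𝕜) →ₗ[𝕜] E),
    (∀ b, (∀ j, ‖b j‖ ≤ 1) → ‖u b‖ ≤ 1) →
    ∃ ν : Fin n → ℝ, (∀ j, 0 ≤ ν j) ∧ ∑ j, ν j ≤ K ∧
      ∀ b, ‖u b‖ ≤ K * (∑ j, ν j * ‖b j‖ ^ p) ^ (1 / p)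

theorem sum_rpow_norm_le_of_cotype {q C M : ℝ} (hq : 0 < q) (hC : 0 ≤ C) (hM : 0 ≤ M)
    {n : ℕ} {x : Fin n → E}
    (h : (∑ k, ‖x k‖ ^ q) ^ (1 / q) ≤
      C * (∫ t in (0 : ℝ)..1,
        ‖∑ k : Fin n, ((rademacher ((k : ℕ) + 1) t : ℝ) : 𝕜) • x k‖ ^ 2) ^ ((1 : ℝ) / 2))
    (hI : ∫ t in (0 : ℝ)..1,
        ‖∑ k : Fin n, ((rademacher ((k : ℕ) + 1) t : ℝ) : 𝕜) • x k‖ ^ 2 ≤ M ^ 2) :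
    ∑ k, ‖x k‖ ^ q ≤ (C * M) ^ q := by
  have h0 : 0 ≤ ∫ t in (0 : ℝ)..1,
        ‖∑ k : Fin n, ((rademacher ((k : ℕ) + 1) t : ℝ) : 𝕜) • x k‖ ^ 2 :=
    intervalIntegral.integral_nonneg zero_le_one fun t _ => by positivity
  have h1 := Real.rpow_le_rpow h0 hI (z := 1 / 2) (by norm_num)
  rw [← Real.sqrt_eq_rpow (M ^ 2), Real.sqrt_sq hM] at h1
  have h2 := h.trans (mul_le_mul_of_nonneg_left h1 hC)
  have h3 : 0 ≤ ∑ k, ‖x k‖ ^ q := Finset.sum_nonneg fun _ _ => by positivity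
  have h4 := Real.rpow_le_rpow (by positivity) h2 hq.le
  rwa [← Real.rpow_mul h3, one_div_mul_cancel hq.ne', Real.rpow_one] at h4

theorem sum_rademacher_smul_map {ι : Type*} (u : (ι → 𝕜) →ₗ[𝕜] E) {N : ℕ} (f : Fin N → ι → 𝕜) (t : ℝ) :
    ∑ k : Fin N, ((rademacher ((k : ℕ) + 1) t : ℝ) : 𝕜) • u (f k) =
      u (fun j => ∑ k : Fin N, ((rademacher ((k : ℕ) + 1) t : ℝ) : 𝕜) * f k j) := by
  simp only [← map_smul, ← map_sum]
  congr 1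
  ext j
  simp only [Finset.sum_apply, Pi.smul_apply, smul_eq_mul]

/-- If `∑ |f_i(j)| ≤ 1` for all `j`, every signed sum of the `f_i` lies in the unit ball of `ℓ_∞^n`,
so cotype gives `∑ ‖u f_i‖^q ≤ C^q`, the hypothesis with `θ = 1`. -/
theorem HasCotype.exists_domination {q p : ℝ} (hE : HasCotype 𝕜 E q) (hq : 1 < q) (hqp : q < p) :
    HasPietschDomination 𝕜 E p := by
  obtain ⟨C, hC, h⟩ := hE
  have hq0 : 0 < q := by linarith
  set L := 1 + 2 * q ^ (1 / q) * (1 - (2 : ℝ) ^ (1 - p / q))⁻¹ with hL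
  refine ⟨max (C ^ q) L, lt_max_of_lt_left (by positivity), fun n u hu => ?_⟩
  obtain ⟨ν, hν0, hν1, hν⟩ := exists_weights_rpow_norm_le (u := u) (D := C ^ q) hq le_rfl
    (fun N f hf => by
      simp only [Real.rpow_one] at hf
      have := sum_rpow_norm_le_of_cotype (M := 1) hq0 hC.le zero_le_one (h N fun i => u (f i)) ?_
      · rwa [mul_one] at this
      · refine (Real.le_norm_self _).trans
          ((intervalIntegral.norm_integral_le_of_norm_le_const (C := 1) fun t _ => ?_).trans ?_)
        swap
        · norm_num
        rw [norm_pow, norm_norm, sum_rademacher_smul_map]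
        refine pow_le_one₀ (norm_nonneg _) (hu _ fun j => (norm_sum_le _ _).trans ?_)
        refine le_trans (Finset.sum_le_sum fun k _ => ?_) (hf j)
        rw [norm_mul, RCLike.norm_ofReal]
        exact mul_le_of_le_one_left (norm_nonneg _) (abs_rademacher_le_one _ _))
  simp only [Real.rpow_one] at hν
  refine ⟨ν, hν0, hν1.trans (le_max_left _ _), fun b => ?_⟩
  refine (norm_le_mul_rpow_of_rpow_norm_le hq hqp hν0 hu hν b).trans ?_
  refine mul_le_mul_of_nonneg_right (le_max_right _ _) (Real.rpow_nonneg ?_ _)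
  exact Finset.sum_nonneg fun j _ => mul_nonneg (hν0 j) (by positivity)

/-- Bootstrapping: domination with `p = 4` and Khinchin control `∫ ‖u(∑ r_i f_i)‖²` when only `∑
|f_i(j)|² ≤ 1`. Cotype 2 then makes `u` 2-summing, so the variational lemma applies with `q = θ =
2`, and no exponent is lost. -/
theorem HasCotype.exists_domination_two (hE : HasCotype 𝕜 E 2) :
    HasPietschDomination 𝕜 E 2 := by
  obtain ⟨K, hK, h4⟩ := hE.exists_domination (p := 4) one_lt_two (by norm_num)
  obtain ⟨C, hC, h⟩ := hE
  set M := Real.sqrt (K ^ 2 * ((1 + 6 * K) / 2)) with hM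
  have hM2 : M ^ 2 = K ^ 2 * ((1 + 6 * K) / 2) := Real.sq_sqrt (by positivity)
  refine ⟨max ((C * M) ^ (2 : ℝ)) 2, by positivity, fun n u hu => ?_⟩
  obtain ⟨ν, hν0, hν1, hν⟩ := h4 n u hu
  obtain ⟨μ, hμ0, hμ1, hμ⟩ := exists_weights_rpow_norm_le (u := u) (q := 2) (θ := 2)
    (D := (C * M) ^ (2 : ℝ)) one_lt_two one_le_two (fun N f hf => by
      refine sum_rpow_norm_le_of_cotype two_pos hC.le (Real.sqrt_nonneg _) (h N fun i => u (f i)) ?_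
      let R : Fin n → ℝ → ℝ := fun j t =>
        2 * rademacherSum (fun k => RCLike.re (f k j)) t ^ 4 +
        2 * rademacherSum (fun k => RCLike.im (f k j)) t ^ 4
      have hRi : ∀ j, IntervalIntegrable (R j) MeasureTheory.volume 0 1 := fun j =>
        ((intervalIntegrable_comp_rademacherSum _ (continuous_pow 4) 0 1).const_mul 2).add
          ((intervalIntegrable_comp_rademacherSum _ (continuous_pow 4) 0 1).const_mul 2)
      have hsum : IntervalIntegrable (fun t => ∑ j, ν j * R j t) MeasureTheory.volume 0 1 :=
        by
          simpa only [Finset.sum_fn] using IntervalIntegrable.sum Finset.univ fun j _ => (hRi j).const_mul (ν j)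
      have hint : ∫ t in (0 : ℝ)..1, K ^ 2 * ((1 + ∑ j, ν j * R j t) / 2) ≤ M ^ 2 := by
        rw [intervalIntegral.integral_const_mul, intervalIntegral.integral_div,
          intervalIntegral.integral_add intervalIntegrable_const hsum,
          intervalIntegral.integral_finsetSum fun j _ => (hRi j).const_mul _, hM2]
        simp only [intervalIntegral.integral_const_mul, intervalIntegral.integral_const, sub_zero,
          one_smul]
        gcongr
        calc ∑ j, ν j * ∫ t in (0 : ℝ)..1, R j t ≤ ∑ j, ν j * 6 :=
              Finset.sum_le_sum fun j _ => mul_le_mul_of_nonneg_left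
                (integral_re_im_rademacherSum_le _ (by simpa using hf j)) (hν0 j)
          _ ≤ 6 * K := by rw [← Finset.sum_mul]; linarith
      refine le_trans ?_ hint
      rw [intervalIntegral.integral_of_le zero_le_one, intervalIntegral.integral_of_le zero_le_one]
      refine MeasureTheory.integral_mono_of_nonneg (Filter.Eventually.of_forall fun t => by positivity)
        ?_ (Filter.Eventually.of_forall fun t => ?_)
      · rw [← MeasureTheory.IntegrableOn, ← intervalIntegrable_iff_integrableOn_Ioc_of_le zero_le_one]
        exact ((intervalIntegrable_const.add hsum).div_const 2).const_mul _
      · simp only [sum_rademacher_smul_map]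
        set b : Fin n → 𝕜 := fun j => ∑ k : Fin N, ((rademacher ((k : ℕ) + 1) t : ℝ) : 𝕜) * f k j
        set A := ∑ j, ν j * ‖b j‖ ^ (4 : ℝ)
        have hA0 : 0 ≤ A := Finset.sum_nonneg fun j _ => mul_nonneg (hν0 j) (by positivity)
        have hA : A ≤ ∑ j, ν j * R j t := Finset.sum_le_sum fun j _ =>
          mul_le_mul_of_nonneg_left (by
            have := norm_sum_rademacher_mul_pow_four_le (fun k => f k j) t
            exact_mod_cast this) (hν0 j)
        have h1 := pow_le_pow_left₀ (norm_nonneg _) (hν b) 2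
        have h2 : (A ^ (1 / (4 : ℝ))) ^ 2 = Real.sqrt A := by
          rw [← Real.rpow_natCast, ← Real.rpow_mul hA0, Real.sqrt_eq_rpow]; norm_num
        -- Replaces Jensen's inequality for the square root; it is the source of `(1 + 6K)/2` in
        -- `M`.
        have h3 : Real.sqrt A ≤ (1 + A) / 2 := by
          nlinarith [sq_nonneg (Real.sqrt A - 1), Real.sq_sqrt hA0]
        rw [mul_pow, h2] at h1
        refine h1.trans (mul_le_mul_of_nonneg_left ?_ (by positivity))
        linarith)
  refine ⟨μ, hμ0, hμ1.trans (le_max_left _ _), fun b => ?_⟩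
  refine le_trans (le_mul_rpow_of_homogeneous (K := 2) two_pos hμ0 (fun b hb => ?_) b) ?_
  -- The estimate `hμ` needs `|b_j| ≤ 1`; both sides have degree 2, so scaling by `1/t` removes the
  -- restriction.
  · set t : ℝ := 1 + ∑ j, ‖b j‖ with ht
    have hs : 0 ≤ ∑ j, ‖b j‖ := Finset.sum_nonneg fun _ _ => norm_nonneg _
    have ht0 : 0 < t := by linarith
    have hn : ∀ j, ‖(((t⁻¹ : ℝ) : 𝕜) • b) j‖ = t⁻¹ * ‖b j‖ := fun j => by
      rw [Pi.smul_apply, norm_smul, RCLike.norm_ofReal, abs_of_pos (inv_pos.2 ht0)]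
    have h1 := hμ (((t⁻¹ : ℝ) : 𝕜) • b) fun j => by
      rw [hn, inv_mul_le_one₀ ht0]
      linarith [Finset.single_le_sum (fun i _ => norm_nonneg (b i)) (Finset.mem_univ j)]
    simp only [hn, map_smul, norm_smul, RCLike.norm_ofReal, abs_of_pos (inv_pos.2 ht0),
      Real.mul_rpow (inv_pos.2 ht0).le (norm_nonneg _), mul_left_comm _ (t⁻¹ ^ (2 : ℝ))] at h1
    rw [← Finset.mul_sum, mul_left_comm] at h1
    have h2 := le_of_mul_le_mul_left h1 (by positivity)
    rw [Real.rpow_two] at h2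
    nlinarith [norm_nonneg (u b)]
  · refine mul_le_mul_of_nonneg_right (le_max_right _ _) (Real.rpow_nonneg ?_ _)
    exact Finset.sum_nonneg fun j _ => mul_nonneg (hμ0 j) (by positivity)

end Cotype

/-! ### Sequence norms over general index sets -/

section SeqNorm

variable {ι : Type*} {G : Type*} [NormedAddCommGroup G] {p q : ℝ≥0∞}

theorem seqNorm_top (u : ι → G) : seqNorm ∞ u = ⨆ i, ‖u i‖ₑ := if_pos rfl

theorem seqNorm_of_ne_top (hp : p ≠ ∞) (u : ι → G) :
    seqNorm p u = (∑' i, ‖u i‖ₑ ^ p.toReal) ^ (1 / p.toReal) := if_neg hp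

theorem seqNorm_eq_eLpNorm_count [MeasurableSpace ι] [MeasurableSingletonClass ι] (hp : p ≠ 0)
    (u : ι → G) : seqNorm p u = MeasureTheory.eLpNorm u p MeasureTheory.Measure.count := by
  by_cases h : p = ∞
  · rw [h, seqNorm_top, MeasureTheory.eLpNorm_exponent_top, MeasureTheory.eLpNormEssSup_count]
  · rw [seqNorm_of_ne_top h, MeasureTheory.eLpNorm_eq_lintegral_rpow_enorm_toReal hp h,
      MeasureTheory.lintegral_count]

theorem seqNorm_le_iff (hp : p ≠ 0) (hp' : p ≠ ∞) {u : ι → G} {B : ℝ≥0∞} :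
    seqNorm p u ≤ B ↔ ∑' i, ‖u i‖ₑ ^ p.toReal ≤ B ^ p.toReal := by
  rw [seqNorm_of_ne_top hp', one_div, ENNReal.rpow_inv_le_iff (ENNReal.toReal_pos hp hp')]

theorem enorm_le_seqNorm (hp : p ≠ 0) (u : ι → G) (i : ι) : ‖u i‖ₑ ≤ seqNorm p u := by
  by_cases h : p = ∞
  · rw [h, seqNorm_top]; exact le_iSup (fun i => ‖u i‖ₑ) i
  · rw [seqNorm_of_ne_top h, one_div, ENNReal.le_rpow_inv_iff (ENNReal.toReal_pos hp h)]
    exact ENNReal.le_tsum i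

theorem seqNorm_anti_exponent (hp : p ≠ 0) (hpq : p ≤ q) (u : ι → G) :
    seqNorm q u ≤ seqNorm p u := by
  by_cases hq : q = ∞
  · rw [hq, seqNorm_top]
    exact iSup_le fun i => enorm_le_seqNorm hp u i
  have hp' : p ≠ ∞ := ne_top_of_le_ne_top hq hpq
  have hq0 : q ≠ 0 := (hp.bot_lt.trans_le hpq).ne'
  have hle : p.toReal ≤ q.toReal := (ENNReal.toReal_le_toReal hp' hq).2 hpq
  have hp0 := ENNReal.toReal_pos hp hp'
  rw [seqNorm_le_iff hq0 hq]
  have hsplit : ∀ x : ℝ≥0∞, x ^ q.toReal = x ^ (q.toReal - p.toReal) * x ^ p.toReal := fun x => by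
    rw [← ENNReal.rpow_add_of_nonneg _ _ (sub_nonneg.2 hle) hp0.le, sub_add_cancel]
  calc ∑' i, ‖u i‖ₑ ^ q.toReal
      ≤ ∑' i, seqNorm p u ^ (q.toReal - p.toReal) * ‖u i‖ₑ ^ p.toReal := by
        refine ENNReal.tsum_le_tsum fun i => ?_
        rw [hsplit]
        exact mul_le_mul_left (ENNReal.rpow_le_rpow (enorm_le_seqNorm hp u i)
          (sub_nonneg.2 hle)) _
    _ = seqNorm p u ^ (q.toReal - p.toReal) * ∑' i, ‖u i‖ₑ ^ p.toReal := ENNReal.tsum_mul_left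
    _ ≤ seqNorm p u ^ (q.toReal - p.toReal) * seqNorm p u ^ p.toReal := by
        gcongr
        exact (seqNorm_le_iff hp hp').1 le_rfl
    _ = _ := (hsplit _).symm

theorem seqNorm_comp_le {κ : Type*} {e : κ → ι} (he : Function.Injective e) (u : ι → G) :
    seqNorm p (fun j => u (e j)) ≤ seqNorm p u := by
  by_cases h : p = ∞
  · rw [h, seqNorm_top, seqNorm_top]
    exact iSup_comp_le (fun i => ‖u i‖ₑ) e
  · rw [seqNorm_of_ne_top h, seqNorm_of_ne_top h]
    exact ENNReal.rpow_le_rpow (ENNReal.tsum_comp_le_tsum_of_injective he fun i =>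
      ‖u i‖ₑ ^ p.toReal) (by positivity)

/-- Each finite set of multi-indices lies in a cube `{0, …, n-1}^m`. This reduces the main estimate
to finite segments. -/
theorem seqNorm_le_of_forall_fin (hp : p ≠ 0) {m : ℕ} {u : (Fin m → ℕ) → G} {B : ℝ≥0∞}
    (h : ∀ n : ℕ, seqNorm p (fun j : Fin m → Fin n => u fun k => j k) ≤ B) : seqNorm p u ≤ B := by
  have hlt : ∀ s : Finset (Fin m → ℕ), ∃ n, ∀ i ∈ s, ∀ k, i k < n := fun s =>
    ⟨s.sup (fun i => Finset.univ.sup i) + 1, fun i hi k => Nat.lt_succ_of_le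
      ((Finset.le_sup (f := i) (Finset.mem_univ k)).trans
        (Finset.le_sup (f := fun i : Fin m → ℕ => Finset.univ.sup i) hi))⟩
  by_cases hp' : p = ∞
  · subst hp'
    rw [seqNorm_top]
    refine iSup_le fun i => ?_
    obtain ⟨n, hn⟩ := hlt {i}
    refine le_trans ?_ (h n)
    exact enorm_le_seqNorm hp (fun j : Fin m → Fin n => u fun k => j k)
      fun k => ⟨i k, hn i (Finset.mem_singleton_self i) k⟩
  · rw [seqNorm_le_iff hp hp', ENNReal.tsum_eq_iSup_sum]
    refine iSup_le fun s => ?_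
    obtain ⟨n, hn⟩ := hlt s
    refine le_trans ?_ ((seqNorm_le_iff hp hp').1 (h n))
    rw [tsum_fintype]
    classical
    rw [← Finset.sum_image (s := Finset.univ) (g := fun (j : Fin m → Fin n) k => (j k : ℕ))
      (f := fun i => ‖u i‖ₑ ^ p.toReal)]
    · refine Finset.sum_le_sum_of_subset fun i hi => Finset.mem_image.2
        ⟨fun k => ⟨i k, hn i hi k⟩, Finset.mem_univ _, rfl⟩
    · intro i _ j _ hij
      ext k
      exact congrFun hij k

theorem seqNorm_prod_le {m n : ℕ} (hp : p ≠ 0) (hp' : p ≠ ∞) (α : Fin m → Fin n → ℝ) :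
    seqNorm p (fun j : Fin m → Fin n => ∏ k, α k (j k)) ≤ ∏ k, seqNorm p (α k) := by
  rw [seqNorm_le_iff hp hp', ← ENNReal.prod_rpow_of_nonneg ENNReal.toReal_nonneg, tsum_fintype]
  have : ∀ j : Fin m → Fin n, ‖∏ k, α k (j k)‖ₑ ^ p.toReal = ∏ k, ‖α k (j k)‖ₑ ^ p.toReal :=
    fun j => by
      rw [ENNReal.prod_rpow_of_nonneg ENNReal.toReal_nonneg]
      simp only [enorm_eq_nnnorm, nnnorm_prod, ENNReal.ofNNReal_finsetProd]
  simp only [this]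
  rw [← Fintype.piFinset_univ,
    ← Finset.prod_univ_sum (fun _ => Finset.univ) fun k i => ‖α k i‖ₑ ^ p.toReal]
  refine Finset.prod_le_prod' fun k _ => ?_
  rw [← tsum_fintype (L := .unconditional _)]
  exact (seqNorm_le_iff hp hp').1 le_rfl

end SeqNorm

/-! ### Factoring weakly 1-summable sequences -/

section Factorization

variable {𝕜 : Type*} [RCLike 𝕜] {E : Type*} [NormedAddCommGroup E] [NormedSpace 𝕜 E]

/-- `W` bounds the norm of `e_j ↦ x_j` on `ℓ_∞^n`. It is a real number even when the weak norm is
infinite, so the operator can be normalized. -/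
theorem exists_norm_sum_smul_le_weakNorm_one (x : ℕ → E) (n : ℕ) :
    ∃ W : ℝ, 0 ≤ W ∧ ENNReal.ofReal W ≤ weakNorm 𝕜 1 x ∧
      ∀ b : Fin n → 𝕜, (∀ j, ‖b j‖ ≤ 1) → ‖∑ j, b j • x j‖ ≤ W := by
  by_cases h : weakNorm 𝕜 1 x = ∞
  · refine ⟨∑ j : Fin n, ‖x j‖, Finset.sum_nonneg fun _ _ => norm_nonneg _, h ▸ le_top,
      fun b hb => (norm_sum_le _ _).trans (Finset.sum_le_sum fun j _ => ?_)⟩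
    rw [norm_smul]
    exact mul_le_of_le_one_left (norm_nonneg _) (hb j)
  · refine ⟨(weakNorm 𝕜 1 x).toReal, ENNReal.toReal_nonneg, ENNReal.ofReal_toReal_le,
      fun b hb => ?_⟩
    obtain ⟨φ, hφ1, hφ⟩ := exists_dual_vector'' 𝕜 (∑ j, b j • x j)
    have h1 : ‖∑ j, b j • x j‖ ≤ ∑ j : Fin n, ‖φ (x j)‖ := by
      have : ‖φ (∑ j, b j • x j)‖ = ‖∑ j, b j • x j‖ := by
        rw [hφ, RCLike.norm_ofReal, abs_norm]
      rw [← this, map_sum]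
      refine (norm_sum_le _ _).trans (Finset.sum_le_sum fun j _ => ?_)
      rw [map_smul, norm_smul]
      exact mul_le_of_le_one_left (norm_nonneg _) (hb j)
    refine h1.trans ((ENNReal.ofReal_le_iff_le_toReal h).1 ?_)
    rw [ENNReal.ofReal_sum_of_nonneg fun _ _ => norm_nonneg _]
    simp only [ofReal_norm]
    calc ∑ j : Fin n, ‖φ (x j)‖ₑ = ∑ j ∈ Finset.range n, ‖φ (x j)‖ₑ :=
          Fin.sum_univ_eq_sum_range (fun j => ‖φ (x j)‖ₑ) n
      _ ≤ ∑' j, ‖φ (x j)‖ₑ := ENNReal.sum_le_tsum _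
      _ = seqNorm 1 (fun j => φ (x j)) := by simp [seqNorm_of_ne_top]
      _ ≤ weakNorm 𝕜 1 x := le_iSup₂ (f := fun (φ : E →L[𝕜] 𝕜) (_ : ‖φ‖ ≤ 1) =>
          seqNorm 1 fun j => φ (x j)) φ hφ1

/-- `ℓ_p`–`ℓ_r` duality: testing `h` on `b_j = α_j⁻¹ |φ(y_j)|^(r-1) ω_j`, with `ω_j` the phase
aligning `φ(y_j)`, gives `A ≤ K A^(1/p)` for the sum `A` to be bounded. -/
theorem sum_rpow_norm_dual_le {n : ℕ} {p r K : ℝ} (hrp : r.HolderConjugate p) {x y : Fin n → E}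
    {α : Fin n → ℝ} (hα : ∀ j, 0 ≤ α j) (hK : 0 ≤ K) (hy : ∀ j, y j = (((α j)⁻¹ : ℝ) : 𝕜) • x j)
    (h : ∀ b : Fin n → 𝕜, ‖∑ j, b j • x j‖ ≤ K * (∑ j, α j ^ p * ‖b j‖ ^ p) ^ (1 / p))
    (φ : E →L[𝕜] 𝕜) (hφ : ‖φ‖ ≤ 1) :
    ∑ j, ‖φ (y j)‖ ^ r ≤ K ^ r := by
  set A := ∑ j, ‖φ (y j)‖ ^ r with hA
  have hA0 : 0 ≤ A := Finset.sum_nonneg fun _ _ => by positivity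
  have hr := hrp.pos
  have hp := hrp.symm.pos
  choose ω hω1 hω using fun j => RCLike.exists_norm_eq_mul_self (φ (y j))
  let c : Fin n → 𝕜 := fun j => ((‖φ (y j)‖ ^ (r - 1) : ℝ) : 𝕜) * ω j
  let b : Fin n → 𝕜 := fun j => (((α j)⁻¹ : ℝ) : 𝕜) * c j
  have hc : ∀ j, ‖c j‖ = ‖φ (y j)‖ ^ (r - 1) := fun j => by
    rw [norm_mul, hω1, mul_one, RCLike.norm_ofReal, abs_of_nonneg (by positivity)]
  have hcp : ∀ j, ‖c j‖ ^ p = ‖φ (y j)‖ ^ r := fun j => by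
    rw [hc, ← Real.rpow_mul (norm_nonneg _), hrp.sub_one_mul_conj]
  have h1 : φ (∑ j, b j • x j) = ((A : ℝ) : 𝕜) := by
    rw [map_sum, hA, RCLike.ofReal_sum]
    refine Finset.sum_congr rfl fun j _ => ?_
    have e1 : b j • x j = c j • y j := by
      rw [hy j, smul_smul, mul_comm]
    rw [e1, map_smul, smul_eq_mul]
    simp only [c]
    rw [mul_assoc, ← hω, ← RCLike.ofReal_mul]
    congr 1
    rcases (norm_nonneg (φ (y j))).eq_or_lt with h0 | h0
    · rw [← h0, Real.zero_rpow hr.ne', mul_zero]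
    · rw [Real.rpow_sub_one h0.ne', div_mul_cancel₀ _ h0.ne']
  have h2 : A ≤ ‖∑ j, b j • x j‖ := by
    calc A = ‖φ (∑ j, b j • x j)‖ := by rw [h1, RCLike.norm_ofReal, abs_of_nonneg hA0]
      _ ≤ 1 * ‖∑ j, b j • x j‖ := φ.le_of_opNorm_le hφ _
      _ = _ := one_mul _
  have h3 : ∑ j, α j ^ p * ‖b j‖ ^ p ≤ A := by
    refine Finset.sum_le_sum fun j _ => ?_
    have hb : ‖b j‖ = (α j)⁻¹ * ‖c j‖ := by
      rw [norm_mul, RCLike.norm_ofReal, abs_of_nonneg (inv_nonneg.2 (hα j))]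
    rw [hb, ← Real.mul_rpow (hα j) (mul_nonneg (inv_nonneg.2 (hα j)) (norm_nonneg _)), ← hcp j]
    refine Real.rpow_le_rpow (mul_nonneg (hα j) (mul_nonneg (inv_nonneg.2 (hα j)) (norm_nonneg _)))
      ?_ hp.le
    rw [← mul_assoc]
    exact mul_le_of_le_one_left (norm_nonneg _) mul_inv_le_one
  have h4 : A ≤ K * A ^ (1 / p) := by
    refine (h2.trans (h b)).trans (mul_le_mul_of_nonneg_left ?_ hK)
    exact Real.rpow_le_rpow (Finset.sum_nonneg fun j _ => mul_nonneg
      (Real.rpow_nonneg (hα j) _) (by positivity)) h3 (by positivity)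
  rcases hA0.eq_or_lt with h0 | h0
  · rw [← h0]; positivity
  · have h5 : A ^ (1 / r) ≤ K := by
      have e : A = A ^ (1 / r) * A ^ (1 / p) := by
        rw [← Real.rpow_add h0, one_div, one_div, hrp.inv_add_inv_eq_one, Real.rpow_one]
      refine le_of_mul_le_mul_right ?_ (Real.rpow_pos_of_pos h0 (1 / p))
      rwa [← e]
    have h6 := Real.rpow_le_rpow (by positivity) h5 hr.le
    rwa [← Real.rpow_mul hA0, one_div_mul_cancel hr.ne', Real.rpow_one] at h6

theorem HasPietschDomination.exists_factorization {p r : ℝ} (hE : HasPietschDomination 𝕜 E p)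
    (hrp : r.HolderConjugate p) :
    ∃ K : ℝ≥0, 0 < K ∧ ∀ (x : ℕ → E) (n : ℕ), ∃ (α : Fin n → ℝ) (y : ℕ → E),
      (∀ j : Fin n, x j = (α j : 𝕜) • y j) ∧ seqNorm (ENNReal.ofReal p) α ≤ K ∧
      WeaklySummable 𝕜 (ENNReal.ofReal r) y ∧
      weakNorm 𝕜 (ENNReal.ofReal r) y ≤ K * weakNorm 𝕜 1 x := by
  classical
  obtain ⟨K, hK, hdom⟩ := hE
  have hp := hrp.symm.pos
  have hr := hrp.pos
  have hp0 : ENNReal.ofReal p ≠ 0 := (ENNReal.ofReal_pos.2 hp).ne'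
  have hr0 : ENNReal.ofReal r ≠ 0 := (ENNReal.ofReal_pos.2 hr).ne'
  have hL : 0 < max K (K ^ (1 / p)) := lt_max_of_lt_left hK
  -- `K^(1/p)` bounds `‖α‖_p`, since `∑ α^p ≤ K`; `K` bounds the weak norm of `y`.
  refine ⟨(max K (K ^ (1 / p))).toNNReal, Real.toNNReal_pos.2 hL, fun x n => ?_⟩
  obtain ⟨W, hW0, hWx, hW⟩ := exists_norm_sum_smul_le_weakNorm_one (𝕜 := 𝕜) x n
  have hfin : ∃ (α : Fin n → ℝ) (z : Fin n → E), (∀ j, 0 ≤ α j) ∧ (∀ j : Fin n, x j = (α j : 𝕜) • z j) ∧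
      ∑ j, α j ^ p ≤ K ∧ ∀ φ : E →L[𝕜] 𝕜, ‖φ‖ ≤ 1 → ∑ j, ‖φ (z j)‖ ^ r ≤ (K * W) ^ r := by
    have hxW : ∀ j : Fin n, ‖x j‖ ≤ W := fun j => by
      simpa [Pi.single_apply, ite_smul] using hW (Pi.single j 1) fun i => by
        by_cases h : i = j <;> simp [h]
    rcases hW0.eq_or_lt with h0 | h0
    · refine ⟨0, 0, fun _ => le_rfl, fun j => ?_, ?_, fun φ _ => ?_⟩
      · simpa [← h0] using hxW j
      · simp [Real.zero_rpow hp.ne', hK.le]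
      · simp only [Pi.zero_apply, map_zero, norm_zero, Real.zero_rpow hr.ne', Finset.sum_const_zero]
        positivity
    · have hnu : ∀ b : Fin n → 𝕜,
          ‖(((W⁻¹ : ℝ) : 𝕜) • Fintype.linearCombination 𝕜 fun j : Fin n => x j) b‖ =
          W⁻¹ * ‖∑ j, b j • x j‖ := fun b => by
        rw [LinearMap.smul_apply, norm_smul, RCLike.norm_ofReal, abs_of_pos (inv_pos.2 h0),
          Fintype.linearCombination_apply]
      obtain ⟨ν, hν0, hν1, hν⟩ := hdom n
        (((W⁻¹ : ℝ) : 𝕜) • Fintype.linearCombination 𝕜 fun j : Fin n => x j) fun b hb => by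
          rw [hnu, inv_mul_le_one₀ h0]
          exact hW b hb
      have hνp : ∀ j, (ν j ^ (1 / p)) ^ p = ν j := fun j => by
        rw [← Real.rpow_mul (hν0 j), one_div_mul_cancel hp.ne', Real.rpow_one]
      have hν' : ∀ b : Fin n → 𝕜, ‖∑ j, b j • x j‖ ≤
          K * W * (∑ j, (ν j ^ (1 / p)) ^ p * ‖b j‖ ^ p) ^ (1 / p) := fun b => by
        have := hν b
        rw [hnu, inv_mul_le_iff₀ h0] at this
        simp only [hνp]
        linarith
      refine ⟨fun j => ν j ^ (1 / p), fun j => (((ν j ^ (1 / p))⁻¹ : ℝ) : 𝕜) • x j,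
        fun j => Real.rpow_nonneg (hν0 j) _, fun j => ?_, ?_, fun φ hφ => ?_⟩
      · rcases (hν0 j).eq_or_lt with hj | hj
        -- Where `ν_j = 0`, the domination tested on `e_j` forces `x_j = 0`, so dividing by `α_j =
        -- 0` is harmless.
        · have : ‖x j‖ ≤ 0 := by
            have h1 := hν' (Pi.single j 1)
            have h2 : ∑ i, (ν i ^ (1 / p)) ^ p * ‖(Pi.single j 1 : Fin n → 𝕜) i‖ ^ p = 0 := by
              refine Finset.sum_eq_zero fun i _ => ?_
              by_cases h : i = j
              · subst h; rw [hνp, ← hj, zero_mul]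
              · simp [h, Real.zero_rpow hp.ne']
            rw [h2, Real.zero_rpow (one_div_pos.2 hp).ne', mul_zero] at h1
            simpa [Pi.single_apply, ite_smul] using h1
          simp only [norm_le_zero_iff.1 this, smul_zero]
        · have : ν j ^ (1 / p) ≠ 0 := (Real.rpow_pos_of_pos hj _).ne'
          rw [smul_smul, ← RCLike.ofReal_mul, mul_inv_cancel₀ this, RCLike.ofReal_one, one_smul]
      · simpa only [hνp] using hν1
      · exact sum_rpow_norm_dual_le hrp (fun j => Real.rpow_nonneg (hν0 j) _) (by positivity)
          (fun _ => rfl) hν' φ hφ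
  obtain ⟨α, z, hα0, hxz, hα, hz⟩ := hfin
  have hz0 : ∀ j ∉ Finset.range n, (if h : j < n then z ⟨j, h⟩ else 0) = 0 := fun j hj =>
    dif_neg (by simpa using hj)
  refine ⟨α, fun j => if h : j < n then z ⟨j, h⟩ else 0, fun j => by simp [hxz], ?_, ?_, ?_⟩
  · rw [seqNorm_le_iff hp0 ENNReal.ofReal_ne_top, tsum_fintype, ENNReal.toReal_ofReal hp.le]
    have h1 : ∀ j, ‖α j‖ₑ ^ p = ENNReal.ofReal (α j ^ p) := fun j => by
      rw [Real.enorm_of_nonneg (hα0 j), ENNReal.ofReal_rpow_of_nonneg (hα0 j) hp.le]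
    simp only [h1]
    rw [← ENNReal.ofReal_sum_of_nonneg fun j _ => Real.rpow_nonneg (hα0 j) _]
    rw [← ENNReal.ofReal, ENNReal.ofReal_rpow_of_nonneg hL.le hp.le]
    refine ENNReal.ofReal_le_ofReal (hα.trans ?_)
    calc K = (K ^ (1 / p)) ^ p := by
          rw [← Real.rpow_mul hK.le, one_div_mul_cancel hp.ne', Real.rpow_one]
      _ ≤ _ := Real.rpow_le_rpow (by positivity) (le_max_right _ _) hp.le
  · intro φ
    refine (memℓp_zero ((Finset.range n).finite_toSet.subset fun j hj => ?_)).of_exponent_ge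
      zero_le
    by_contra h
    exact hj (by simp only [hz0 j (by simpa using h), map_zero])
  · refine iSup₂_le fun φ hφ => ?_
    rw [seqNorm_le_iff hr0 ENNReal.ofReal_ne_top, ENNReal.toReal_ofReal hr.le,
      tsum_eq_sum (s := Finset.range n) fun j hj => by
        simp only [hz0 j hj, map_zero, enorm_zero, ENNReal.zero_rpow_of_pos hr],
      Finset.sum_range]
    have h1 : ∀ j : Fin n, ‖φ (if h : (j : ℕ) < n then z ⟨j, h⟩ else 0)‖ₑ ^ r =
        ENNReal.ofReal (‖φ (z j)‖ ^ r) := fun j => by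
      rw [dif_pos j.2, ← ofReal_norm, ENNReal.ofReal_rpow_of_nonneg (norm_nonneg _) hr.le]
    simp only [h1]
    rw [← ENNReal.ofReal_sum_of_nonneg fun j _ => Real.rpow_nonneg (norm_nonneg _) _]
    refine (ENNReal.ofReal_le_ofReal (hz φ hφ)).trans ?_
    rw [← ENNReal.ofReal_rpow_of_nonneg (by positivity) hr.le, ENNReal.ofReal_mul hK.le]
    refine ENNReal.rpow_le_rpow (mul_le_mul' ?_ hWx) hr.le
    exact ENNReal.ofReal_le_ofReal (le_max_left K (K ^ (1 / p)))

end Factorization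

/-! ### Inclusion of the multiple summing classes -/

section Inclusion

variable {𝕜 : Type*} [RCLike 𝕜] {m : ℕ}
    (E : Fin m → Type*) [∀ i, NormedAddCommGroup (E i)] [∀ i, NormedSpace 𝕜 (E i)]
    (F : Type*) [NormedAddCommGroup F] [NormedSpace 𝕜 F]

theorem multipleSumming_mono_left {a s r : ℝ≥0∞} (ha : a ≠ 0) (has : a ≤ s) :
    multipleSumming 𝕜 a r E F ⊆ multipleSumming 𝕜 s r E F := by
  rintro T ⟨C, hC, h⟩
  exact ⟨C, hC, fun x hx => (seqNorm_anti_exponent ha has _).trans (h x hx)⟩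

theorem multipleSumming_subset_of_hasPietschDomination {a s : ℝ≥0∞} {p r : ℝ}
    (hE : ∀ i, HasPietschDomination 𝕜 (E i) p) (hrp : r.HolderConjugate p) (ha : 1 ≤ a)
    (hs : 1 ≤ s) (hars : s⁻¹ ≤ (ENNReal.ofReal p)⁻¹ + a⁻¹) :
    multipleSumming 𝕜 a (ENNReal.ofReal r) E F ⊆ multipleSumming 𝕜 s 1 E F := by
  rintro T ⟨C, hC, hT⟩
  choose K hK hfac using fun i => (hE i).exists_factorization hrp
  -- One factor `K i` pays for `‖α‖_p`, the other for the weak norm of `y`.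
  refine ⟨C * ∏ i, (K i * K i), mul_pos hC (Finset.prod_pos fun i _ => mul_pos (hK i) (hK i)),
    fun x _ => ?_⟩
  have hp0 : ENNReal.ofReal p ≠ 0 := (ENNReal.ofReal_pos.2 hrp.symm.pos).ne'
  have ha0 : a ≠ 0 := (zero_lt_one.trans_le ha).ne'
  have hs0 : s ≠ 0 := (zero_lt_one.trans_le hs).ne'
  refine seqNorm_le_of_forall_fin hs0 fun n => ?_
  choose α y hx hα hy hyw using fun i => hfac i (x i) n
  set σ : ℝ≥0∞ := ((ENNReal.ofReal p)⁻¹ + a⁻¹)⁻¹ with hσ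
  have hσs : σ ≤ s := ENNReal.inv_le_iff_inv_le.1 hars
  have hσ0 : σ ≠ 0 := by
    rw [hσ]; simp [ha0, hrp.symm.pos]
  have : ENNReal.HolderTriple (ENNReal.ofReal p) a σ := ⟨by rw [hσ, inv_inv]⟩
  have hTx : (fun j : Fin m → Fin n => T fun k => x k (j k)) =
      (fun j : Fin m → Fin n => ((∏ k, α k (j k) : ℝ) : 𝕜)) • fun j : Fin m → Fin n => T fun k => y k (j k) := by
    ext j
    simp only [hx, MultilinearMap.map_smul_univ, Pi.smul_apply', RCLike.ofReal_prod]
  calc seqNorm s (fun j : Fin m → Fin n => T fun k => x k (j k))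
      ≤ seqNorm σ (fun j : Fin m → Fin n => T fun k => x k (j k)) :=
        seqNorm_anti_exponent hσ0 hσs _
    _ ≤ seqNorm (ENNReal.ofReal p) (fun j : Fin m → Fin n => ((∏ k, α k (j k) : ℝ) : 𝕜)) *
        seqNorm a (fun j : Fin m → Fin n => T fun k => y k (j k)) := by
        rw [hTx, seqNorm_eq_eLpNorm_count hσ0, seqNorm_eq_eLpNorm_count hp0,
          seqNorm_eq_eLpNorm_count ha0]
        exact MeasureTheory.eLpNorm_smul_le_mul_eLpNorm
          (MeasureTheory.StronglyMeasurable.of_discrete).aestronglyMeasurable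
          (MeasureTheory.StronglyMeasurable.of_discrete).aestronglyMeasurable
    _ ≤ (∏ k, (K k : ℝ≥0∞)) * (C * ∏ k, (K k * weakNorm 𝕜 1 (x k))) := by
        gcongr ?_ * ?_
        · have : seqNorm (ENNReal.ofReal p)
              (fun j : Fin m → Fin n => ((∏ k, α k (j k) : ℝ) : 𝕜)) =
              seqNorm (ENNReal.ofReal p) (fun j : Fin m → Fin n => ∏ k, α k (j k)) := by
            simp only [seqNorm, ← ofReal_norm, RCLike.norm_ofReal, Real.norm_eq_abs]
          rw [this]
          exact (seqNorm_prod_le hp0 ENNReal.ofReal_ne_top α).trans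
            (Finset.prod_le_prod' fun k _ => hα k)
        · refine (seqNorm_comp_le (e := fun (j : Fin m → Fin n) k => (j k : ℕ)) ?_
            (fun j => T fun k => y k (j k))).trans ((hT y hy).trans ?_)
          · intro i j hij
            ext k
            exact congrFun hij k
          · gcongr with k
            exact hyw k
    _ = _ := by
        push_cast
        simp only [Finset.prod_mul_distrib]
        ring

end Inclusion

/-! ### The main theorem: matching the exponents -/

theorem mainTheorem4 {𝕜 : Type*} [RCLike 𝕜] {m : ℕ}
    (E : Fin m → Type*) [∀ i, NormedAddCommGroup (E i)] [∀ i, NormedSpace 𝕜 (E i)]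
    [∀ i, CompleteSpace (E i)]
    (F : Type*) [NormedAddCommGroup F] [NormedSpace 𝕜 F] [CompleteSpace F]
    (hE : ∀ i, ¬ FiniteDimensional 𝕜 (E i))
    (a r s : ℝ≥0∞) (hr : 1 ≤ r) (hra : r ≤ a) (hs : 1 ≤ s)
    (hars : (1 / r).toReal - (1 / a).toReal ≤ 1 - (1 / s).toReal) :
    ((∀ i, HasCotype 𝕜 (E i) 2) → r ≤ 2 →
      multipleSumming 𝕜 a r E F ⊆ multipleSumming 𝕜 s 1 E F) ∧
    (∀ (q : Fin m → ℝ) (qmax : ℝ), (∀ i, 2 < q i) → (∀ i, HasCotype 𝕜 (E i) (q i)) →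
      IsGreatest (Set.range q) qmax → 1 < r → r < ENNReal.ofReal (qmax / (qmax - 1)) →
      multipleSumming 𝕜 a r E F ⊆ multipleSumming 𝕜 s 1 E F) := by
  have hinv : ∀ {t : ℝ≥0∞}, 1 ≤ t → t⁻¹ ≠ ∞ := fun ht =>
    ENNReal.inv_ne_top.2 (zero_lt_one.trans_le ht).ne'
  have ha : 1 ≤ a := hr.trans hra
  simp only [one_div] at hars
  have key : 1 < r → r ≠ ∞ →
      (∀ i, HasPietschDomination 𝕜 (E i) (r.toReal / (r.toReal - 1))) →
      multipleSumming 𝕜 a r E F ⊆ multipleSumming 𝕜 s 1 E F := by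
    intro hr1 hrt hdom
    have hr1' : 1 < r.toReal := by
      rw [← ENNReal.toReal_one]; exact (ENNReal.toReal_lt_toReal ENNReal.one_ne_top hrt).2 hr1
    have hrp : r.toReal.HolderConjugate (r.toReal / (r.toReal - 1)) :=
      Real.HolderConjugate.conjExponent hr1'
    set p := r.toReal / (r.toReal - 1)
    have hp := hrp.symm.pos
    conv_lhs => rw [← ENNReal.ofReal_toReal hrt]
    refine multipleSumming_subset_of_hasPietschDomination E F hdom hrp ha hs ?_
    have hpi : (ENNReal.ofReal p)⁻¹ ≠ ∞ :=
      ENNReal.inv_ne_top.2 (ENNReal.ofReal_pos.2 hp).ne'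
    rw [← ENNReal.toReal_le_toReal (hinv hs) (ENNReal.add_ne_top.2 ⟨hpi, hinv ha⟩),
      ENNReal.toReal_add hpi (hinv ha), ENNReal.toReal_inv (ENNReal.ofReal p),
      ENNReal.toReal_ofReal hp.le]
    have h1 := hrp.inv_add_inv_eq_one
    rw [ENNReal.toReal_inv r] at hars
    linarith
  refine ⟨fun hcot hr2 => ?_, fun q qmax hq hcot hmax hr1 hrq => ?_⟩
  -- For `r = 1` the conjugate exponent would be infinite; monotonicity in the left exponent
  -- suffices.
  · rcases hr.eq_or_lt with rfl | hr1
    · refine multipleSumming_mono_left E F (zero_lt_one.trans_le ha).ne' (ENNReal.inv_le_inv.1 ?_)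
      rw [← ENNReal.toReal_le_toReal (hinv hs) (hinv ha)]
      simp only [inv_one, ENNReal.toReal_one] at hars
      linarith
    · have hrt : r ≠ ∞ := ne_top_of_le_ne_top ENNReal.ofNat_ne_top hr2
      have hr1' : 1 < r.toReal := by
        rw [← ENNReal.toReal_one]; exact (ENNReal.toReal_lt_toReal ENNReal.one_ne_top hrt).2 hr1
      have hr2' : r.toReal ≤ 2 := by
        have := (ENNReal.toReal_le_toReal hrt ENNReal.ofNat_ne_top).2 hr2
        simpa using this
      refine key hr1 hrt fun i => ?_
      rcases hr2'.eq_or_lt with h | h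
      · rw [h]
        norm_num
        exact (hcot i).exists_domination_two
      · refine (hcot i).exists_domination one_lt_two ?_
        rw [lt_div_iff₀ (by linarith)]
        linarith
  · have hrt : r ≠ ∞ := hrq.ne_top
    have hr1' : 1 < r.toReal := by
      rw [← ENNReal.toReal_one]; exact (ENNReal.toReal_lt_toReal ENNReal.one_ne_top hrt).2 hr1
    have hrq' : r.toReal < qmax / (qmax - 1) := by
      rw [← ENNReal.lt_ofReal_iff_toReal_lt hrt]; exact hrq
    -- `r < q*` means `r* > q ≥ q_i`, so the strict-inequality domination applies in each `E_i`.
    refine key hr1 hrt fun i => (hcot i).exists_domination (by linarith [hq i]) ?_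
    have hqi : q i ≤ qmax := hmax.2 ⟨i, rfl⟩
    have := hq i
    rw [lt_div_iff₀ (by linarith)] at hrq' ⊢
    nlinarith
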